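/- **Theorem 5.1.** Let $\epsilon:[0,\infty)\to(0,\infty)$ be differentiable and monotonically decaying, with $\lim_{t\to\infty}\epsilon(t)=0$ and $|\dot\epsilon(t)|/\epsilon(t)<1$ for all $t\ge 0$, and let $M_1\in\mathbb R$, $M_2>0$. There is $R_0>0$, depending only on $\epsilon,M_1,M_2$, such that for every $0<R\le R_0$ there is $\zeta>0$, depending only on $\epsilon,M_1,M_2,R$, with the following property. Let $H$ be a real Hilbert space, $B:H\to H$ a (not necessarily monotone) operator, $f\in H$, $F(u):=B(u)-f$, and let $F(y)=0$. Write $B(y,R)=\{u\in H:\|u-y\|\le R\}$ and suppose that $F$ is twice Fréchet differentiable at every point of $B(y,R)$ with $$\sup_{u\in B(y,R)}\|F^{(j)}(u)\|\le M_j,\qquad j=1,2 .$$ Let $u_0\in B(y,R)$, and let $\tilde u_0,z\in H$ satisfy the source condition $$y-\tilde u_0=F'(y)^*F'(y)z,\qquad \|z\|\le\zeta .$$ For $g\in H$ set, with $A=F'(u)$, $$\Phi_g(t,u):=-(A^*A+\epsilon(t)I)^{-1}\bigl[A^*(B(u)-g)+\epsilon(t)(u-\tilde u_0)\bigr].$$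 (i) (Exact data.) The problem $\dot u=\Phi_f(t,u)$, $u(0)=u_0$, has a unique solution $u$ on $[0,\infty)$. For all $t\ge0$ it satisfies $u(t)\in B(y,R)$ and $$\|u(t)-y\|<\frac{\sqrt{\epsilon(t)}}{2M_2},$$ and $\lim_{t\to\infty}u(t)=y$. (ii) (Noisy data.) There are stopping times $t_\delta\ge0$, $\delta>0$, depending on the noise only through $\delta$, such that for every $\eta>0$ there is $\delta_0>0$ such that for all $0<\delta<\delta_0$ and all $f_\delta\in H$ with $\|f_\delta-f\|\le\delta$ the problem $\dot u_\delta=\Phi_{f_\delta}(t,u_\delta)$, $u_\delta(0)=u_0$, has a unique solution on $[0,t_\delta]$, and $\|u_\delta(t_\delta)-y\|<\eta$. That is, $\lim_{\delta\to0}\|u_\delta(t_\delta)-y\|=0$, uniformly in the data $f_\delta$ with $\|f_\delta-f\|\le\delta$. -/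

import Mathlib

open Set Filter Topology Metric

noncomputable section

/-- A regularization function: on `[0, ∞)` it is positive, differentiable (hence continuous;
one-sidedly at `0`), monotonically decaying to zero, and `|ε'(t)| / ε(t) < 1`. -/
structure IsRegularizationFunction (ε : ℝ → ℝ) : Prop where
  pos : ∀ t ∈ Ici (0 : ℝ), 0 < ε t
  differentiableOn : DifferentiableOn ℝ ε (Ici 0)
  antitoneOn : AntitoneOn ε (Ici 0)
  tendsto_zero : Tendsto ε atTop (𝓝 0)
  relative_decay : ∀ t ∈ Ici (0 : ℝ), |derivWithin ε (Ici 0) t| / ε t < 1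

/-- `F` is twice Fréchet differentiable at every point of `s`, and the operator norms of its first
and second derivatives are bounded on `s` by `M₁` and `M₂`. -/
structure HasBoundedDerivatives {H : Type*} [NormedAddCommGroup H] [InnerProductSpace ℝ H]
    (F : H → H) (s : Set H) (M₁ M₂ : ℝ) : Prop where
  differentiableAt : ∀ u ∈ s, DifferentiableAt ℝ F u
  differentiableAt_fderiv : ∀ u ∈ s, DifferentiableAt ℝ (fderiv ℝ F) u
  norm_fderiv_le : ∀ u ∈ s, ‖fderiv ℝ F u‖ ≤ M₁
  norm_fderiv_fderiv_le : ∀ u ∈ s, ‖fderiv ℝ (fderiv ℝ F) u‖ ≤ M₂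

/-- The operator `A* A`. -/
def normalOp {H : Type*} [NormedAddCommGroup H] [InnerProductSpace ℝ H] [CompleteSpace H]
    (A : H →L[ℝ] H) : H →L[ℝ] H :=
  (ContinuousLinearMap.adjoint A) ∘L A

/-- The operator `A* A + e I`. -/
def regNormalOp {H : Type*} [NormedAddCommGroup H] [InnerProductSpace ℝ H] [CompleteSpace H]
    (A : H →L[ℝ] H) (e : ℝ) : H →L[ℝ] H :=
  normalOp A + e • ContinuousLinearMap.id ℝ H

/-- For `e > 0` the operator `A* A + e I` has a bounded inverse, so that
`ContinuousLinearMap.inverse` is the true inverse wherever it is used below. -/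
theorem regNormalOp_isInvertible {H : Type*} [NormedAddCommGroup H] [InnerProductSpace ℝ H]
    [CompleteSpace H] (A : H →L[ℝ] H) {e : ℝ} (he : 0 < e) :
    (regNormalOp A e).IsInvertible := by
  have h : IsUnit (regNormalOp A e) := by
    refine ContinuousLinearMap.isUnit_of_forall_le_norm_inner_map _ (c := ⟨e, he.le⟩) he ?_
    intro x
    have hx : inner ℝ (regNormalOp A e x) x = ‖A x‖ ^ 2 + e * ‖x‖ ^ 2 := by
      simp [regNormalOp, normalOp, inner_add_left, ContinuousLinearMap.adjoint_inner_left,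
        real_inner_smul_left]
    rw [hx, Real.norm_eq_abs]
    refine le_trans ?_ (le_abs_self _)
    change ‖x‖ ^ 2 * e ≤ _
    nlinarith [sq_nonneg ‖A x‖]
  obtain ⟨w, hw⟩ := h
  exact ⟨ContinuousLinearEquiv.unitsEquiv ℝ H w, by rw [← hw]; rfl⟩

/-- The vector field `Φ(t, u) = -(A* A + ε(t) I)⁻¹ [A* (B(u) - f) + ε(t) (u - p)]` of the regularized
Gauss-Newton flow for the equation `B(u) = f`, where `A` is the derivative of `B` (that is, of
`F = B - f`) at `u`, and `p` is the element at which the regularization is centred. -/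
def gaussNewtonField {H : Type*} [NormedAddCommGroup H] [InnerProductSpace ℝ H] [CompleteSpace H]
    (B : H → H) (f p : H) (ε : ℝ → ℝ) (t : ℝ) (u : H) : H :=
  -((regNormalOp (fderiv ℝ B u) (ε t)).inverse
      (ContinuousLinearMap.adjoint (fderiv ℝ B u) (B u - f) + ε t • (u - p)))

/-- `u` solves the Cauchy problem `u' = Φ(t, u)`, `u(0) = u₀` on the time interval `I` (derivatives
at end points of `I` are one-sided). -/
structure IsSolutionOn {H : Type*} [NormedAddCommGroup H] [InnerProductSpace ℝ H]
    (Φ : ℝ → H → H) (u₀ : H) (I : Set ℝ) (u : ℝ → H) : Prop where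
  initial : u 0 = u₀
  hasDerivWithinAt : ∀ t ∈ I, HasDerivWithinAt u (Φ t (u t)) I t

end

/-! Write `w = u - y` and `A = F'(u)`. The field splits into the contraction `-w`, the image under
`(A*A + ε)⁻¹A*` of the linearization error and the noise, and the image of the source element under
`-ε(A*A + ε)⁻¹`. Resolvent bounds give `⟨w, Φ⟩ ≤ -‖w‖² + ‖w‖(small)` (`inner_gaussNewtonField_le`).

Take `κ²ε(t)` as a barrier for `‖w‖²`, with `κ√ε(0) = R` so that it starts at `R²`. On the barrier
the perturbations are at most `3/8` of `‖w‖`, hence `2⟨w, Φ⟩ < -κ²ε`, while `|ε'| < ε` gives `-κ²ε <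
κ²ε'`: the flow points strictly inside (`inner_gaussNewtonField_lt`). So `‖w‖ ≤ κ√ε(t)`, which
yields the rate and convergence, and keeps solutions in the ball where Picard–Lindelöf applies.
Noise `δ` is tolerated while `δ ≤ κε(t)/4`; stopping at equality leaves an error of order `√δ`. -/

/-- The radial retraction of a normed space onto the closed ball `closedBall y R`. -/
noncomputable def radialRetraction {E : Type*} [NormedAddCommGroup E] [NormedSpace ℝ E]
    (y : E) (R : ℝ) (x : E) : E :=
  y + (R / max R ‖x - y‖) • (x - y)

/-! ### Lipschitz retraction onto a ball -/

section Retraction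

variable {E : Type*} [NormedAddCommGroup E] [NormedSpace ℝ E] {y : E} {R : ℝ}

theorem radialRetraction_mem (hR : 0 < R) (x : E) : radialRetraction y R x ∈ closedBall y R := by
  have hm : 0 < max R ‖x - y‖ := lt_max_of_lt_left hR
  rw [mem_closedBall, dist_eq_norm, radialRetraction, add_sub_cancel_left, norm_smul,
    Real.norm_of_nonneg (by positivity), div_mul_eq_mul_div, div_le_iff₀ hm]
  exact mul_le_mul_of_nonneg_left (le_max_right _ _) hR.le

theorem radialRetraction_of_mem (hR : 0 < R) {x : E} (hx : x ∈ closedBall y R) :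
    radialRetraction y R x = x := by
  rw [mem_closedBall, dist_eq_norm] at hx
  rw [radialRetraction, max_eq_left hx, div_self hR.ne', one_smul, add_sub_cancel]

/-- The difference of values is a scaled `v - w` plus the change of scale times `w`. Each is at most
`‖v - w‖`, as `max R ‖·‖` is 1-Lipschitz and `‖w‖ ≤ b`. -/
theorem lipschitzWith_radialRetraction (hR : 0 < R) :
    LipschitzWith 2 (radialRetraction y R : E → E) := by
  refine LipschitzWith.of_dist_le_mul fun x x' => ?_
  set v := x - y with hv
  set w := x' - y with hw
  have hvw : x - x' = v - w := by simp [hv, hw]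
  set a := max R ‖v‖ with ha
  set b := max R ‖w‖ with hb
  have ha0 : 0 < a := lt_max_of_lt_left hR
  have hb0 : 0 < b := lt_max_of_lt_left hR
  have hRa : R / a ≤ 1 := (div_le_one ha0).2 (le_max_left _ _)
  have hab : |b - a| ≤ ‖v - w‖ := by
    refine (abs_max_sub_max_le_max R ‖w‖ R ‖v‖).trans ?_
    rw [sub_self, abs_zero]
    refine max_le (norm_nonneg _) ?_
    rw [norm_sub_rev v w]
    exact abs_norm_sub_norm_le w v
  have hsplit : radialRetraction y R x - radialRetraction y R x'
      = (R / a) • (v - w) + (R / a - R / b) • w := by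
    simp only [radialRetraction, ← hv, ← hw, ← ha, ← hb]
    module
  have hcoef : (R / a - R / b) = (R / a) * ((b - a) / b) := by
    field_simp
  have hw1 : ‖(R / a - R / b) • w‖ ≤ ‖v - w‖ := by
    rw [hcoef, norm_smul, norm_mul, Real.norm_of_nonneg (by positivity : 0 ≤ R / a), norm_div,
      Real.norm_of_nonneg hb0.le, Real.norm_eq_abs, mul_assoc]
    have h1 : |b - a| / b * ‖w‖ ≤ |b - a| := by
      rw [div_mul_eq_mul_div, div_le_iff₀ hb0]
      exact mul_le_mul_of_nonneg_left (le_max_right _ _) (abs_nonneg _)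
    have h2 : 0 ≤ |b - a| / b * ‖w‖ := by positivity
    calc R / a * (|b - a| / b * ‖w‖) ≤ 1 * (|b - a| / b * ‖w‖) :=
          mul_le_mul_of_nonneg_right hRa h2
      _ ≤ ‖v - w‖ := by rw [one_mul]; exact h1.trans hab
  rw [dist_eq_norm, dist_eq_norm, hsplit, hvw]
  refine (norm_add_le _ _).trans ?_
  rw [norm_smul, Real.norm_of_nonneg (by positivity : 0 ≤ R / a)]
  have := mul_le_mul_of_nonneg_right hRa (norm_nonneg (v - w))
  push_cast
  linarith

end Retraction

/-! ### Barriers and well-posedness of the Cauchy problem -/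

section Barrier

variable {H : Type*} [NormedAddCommGroup H] [InnerProductSpace ℝ H]

theorem IsSolutionOn.mono {Φ : ℝ → H → H} {u₀ : H} {I J : Set ℝ} {u : ℝ → H}
    (h : IsSolutionOn Φ u₀ I u) (hJ : J ⊆ I) : IsSolutionOn Φ u₀ J u :=
  ⟨h.initial, fun t ht => (h.hasDerivWithinAt t (hJ ht)).mono hJ⟩

/-- A solution that starts below the barrier `b` stays below it, if the vector field points
strictly below the barrier wherever it is met. -/
theorem IsSolutionOn.norm_sub_sq_le {Φ : ℝ → H → H} {y u₀ : H} {T : ℝ} {b b' : ℝ → ℝ}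
    {u : ℝ → H} (hu : IsSolutionOn Φ u₀ (Icc 0 T) u)
    (hb : ∀ t ∈ Icc 0 T, HasDerivWithinAt b (b' t) (Icc 0 T) t)
    (h₀ : ‖u₀ - y‖ ^ 2 ≤ b 0)
    (hin : ∀ t ∈ Ico 0 T, ∀ x, ‖x - y‖ ^ 2 = b t → 2 * inner ℝ (x - y) (Φ t x) < b' t) :
    ∀ t ∈ Icc 0 T, ‖u t - y‖ ^ 2 ≤ b t := by
  have hd : ∀ t ∈ Icc 0 T, HasDerivWithinAt (fun t => ‖u t - y‖ ^ 2)
      (2 * inner ℝ (u t - y) (Φ t (u t))) (Icc 0 T) t := fun t ht =>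
    ((hu.hasDerivWithinAt t ht).sub_const y).norm_sq
  refine image_le_of_deriv_right_lt_deriv_boundary'
    (fun t ht => (hd t ht).continuousWithinAt)
    (fun t ht => (hd t (Ico_subset_Icc_self ht)).mono_of_mem_nhdsWithin
      (Icc_mem_nhdsGE_of_mem ht)) (by rwa [hu.initial])
    (fun t ht => (hb t ht).continuousWithinAt)
    (fun t ht => (hb t (Ico_subset_Icc_self ht)).mono_of_mem_nhdsWithin
      (Icc_mem_nhdsGE_of_mem ht)) ?_
  exact fun t ht h => hin t ht _ h

/-- Existence and uniqueness for a vector field that is Lipschitz on a closed ball only, when a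
barrier keeps the solutions in that ball. -/
theorem exists_unique_solution_of_barrier [CompleteSpace H] {Φ : ℝ → H → H} {y u₀ : H}
    {T R : ℝ} (hT : 0 ≤ T) (hR : 0 < R) {K : NNReal} {b b' : ℝ → ℝ}
    (hlip : ∀ t ∈ Icc 0 T, LipschitzOnWith K (Φ t) (closedBall y R))
    (hcont : ∀ x ∈ closedBall y R, ContinuousOn (fun t => Φ t x) (Icc 0 T))
    (hb : ∀ t ∈ Icc 0 T, HasDerivWithinAt b (b' t) (Icc 0 T) t)
    (hbR : ∀ t ∈ Icc 0 T, b t ≤ R ^ 2)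
    (h₀ : ‖u₀ - y‖ ^ 2 ≤ b 0)
    (hin : ∀ t ∈ Ico 0 T, ∀ x, ‖x - y‖ ^ 2 = b t → 2 * inner ℝ (x - y) (Φ t x) < b' t) :
    ∃ u : ℝ → H, IsSolutionOn Φ u₀ (Icc 0 T) u ∧
      (∀ t ∈ Icc 0 T, ‖u t - y‖ ^ 2 ≤ b t) ∧
      ∀ v : ℝ → H, IsSolutionOn Φ u₀ (Icc 0 T) v → EqOn v u (Icc 0 T) := by
  have hball : ∀ t ∈ Icc 0 T, ∀ x, ‖x - y‖ ^ 2 ≤ b t → x ∈ closedBall y R := by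
    intro t ht x hx
    rw [mem_closedBall, dist_eq_norm]
    exact le_of_sq_le_sq (hx.trans (hbR t ht)) hR.le
  have hy : y ∈ closedBall y R := mem_closedBall_self hR.le
  obtain ⟨C, hC⟩ := isCompact_Icc.exists_bound_of_continuousOn (hcont y hy)
  have hC0 : 0 ≤ C := (norm_nonneg _).trans (hC 0 ⟨le_rfl, hT⟩)
  -- `Ψ` is globally Lipschitz and bounded by `C + K R`, so Picard–Lindelöf covers all of `[0, T]`
  -- at once, with radius bound times `T`.
  set Ψ : ℝ → H → H := fun t x => Φ t (radialRetraction y R x) with hΨ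
  have hΨΦ : ∀ t, ∀ x ∈ closedBall y R, Ψ t x = Φ t x := fun t x hx => by
    simp only [hΨ, radialRetraction_of_mem hR hx]
  have hpl : IsPicardLindelof Ψ (⟨0, le_rfl, hT⟩ : Icc 0 T) u₀
      ((C.toNNReal + K * R.toNNReal) * T.toNNReal) 0 (C.toNNReal + K * R.toNNReal) (K * 2) := by
    refine ⟨fun t ht => ?_, fun x _ => hcont _ (radialRetraction_mem hR x), fun t ht x _ => ?_, ?_⟩
    · exact (hlip t ht).comp (lipschitzWith_radialRetraction hR).lipschitzOnWith
        fun x _ => radialRetraction_mem hR x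
    · have hx := radialRetraction_mem (y := y) hR x
      have h1 := (hlip t ht).dist_le_mul _ hx _ hy
      rw [mem_closedBall] at hx
      have h2 := norm_le_norm_add_norm_sub' (Φ t (radialRetraction y R x)) (Φ t y)
      rw [← dist_eq_norm] at h2
      have h3 : (K : ℝ) * dist (radialRetraction y R x) y ≤ K * R := by gcongr
      simp only [hΨ, NNReal.coe_add, NNReal.coe_mul, Real.coe_toNNReal _ hC0,
        Real.coe_toNNReal _ hR.le]
      linarith [hC t ht]
    · simp [hT]
  obtain ⟨u, hu0, hu⟩ := hpl.exists_eq_forall_mem_Icc_hasDerivWithinAt₀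
  have huΨ : IsSolutionOn Ψ u₀ (Icc 0 T) u := ⟨hu0, hu⟩
  -- Contact points with the barrier lie in the ball, where `Ψ = Φ`; hence the solution for `Ψ`
  -- never leaves the ball and solves the original problem.
  have hub : ∀ t ∈ Icc 0 T, ‖u t - y‖ ^ 2 ≤ b t := huΨ.norm_sub_sq_le hb h₀ fun t ht x hx => by
    rw [hΨΦ t x (hball t (Ico_subset_Icc_self ht) x hx.le)]
    exact hin t ht x hx
  have huΦ : IsSolutionOn Φ u₀ (Icc 0 T) u := ⟨hu0, fun t ht => by
    rw [← hΨΦ t _ (hball t ht _ (hub t ht))]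
    exact hu t ht⟩
  refine ⟨u, huΦ, hub, fun v hv => ?_⟩
  have hvb := hv.norm_sub_sq_le hb h₀ hin
  exact ODE_solution_unique_of_mem_Icc_right
    (fun t ht => hlip t (Ico_subset_Icc_self ht))
    (fun t ht => (hv.hasDerivWithinAt t ht).continuousWithinAt)
    (fun t ht => (hv.hasDerivWithinAt t (Ico_subset_Icc_self ht)).mono_of_mem_nhdsWithin
      (Icc_mem_nhdsGE_of_mem ht))
    (fun t ht => hball t (Ico_subset_Icc_self ht) _ (hvb t (Ico_subset_Icc_self ht)))
    (fun t ht => (huΦ.hasDerivWithinAt t ht).continuousWithinAt)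
    (fun t ht => (huΦ.hasDerivWithinAt t (Ico_subset_Icc_self ht)).mono_of_mem_nhdsWithin
      (Icc_mem_nhdsGE_of_mem ht))
    (fun t ht => hball t (Ico_subset_Icc_self ht) _ (hub t (Ico_subset_Icc_self ht)))
    (by rw [hv.initial, hu0])

/-- Solutions on the intervals `[0, n]` that are unique there glue to a unique solution
on `[0, ∞)`. -/
theorem exists_unique_solution_Ici {Φ : ℝ → H → H} {u₀ : H} (P : ℝ → H → Prop)
    (h : ∀ T : ℝ, 0 ≤ T → ∃ u : ℝ → H, IsSolutionOn Φ u₀ (Icc 0 T) u ∧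
      (∀ t ∈ Icc 0 T, P t (u t)) ∧
      ∀ v : ℝ → H, IsSolutionOn Φ u₀ (Icc 0 T) v → EqOn v u (Icc 0 T)) :
    ∃ u : ℝ → H, IsSolutionOn Φ u₀ (Ici 0) u ∧ (∀ t ∈ Ici (0 : ℝ), P t (u t)) ∧
      ∀ v : ℝ → H, IsSolutionOn Φ u₀ (Ici 0) v → EqOn v u (Ici 0) := by
  choose! U hU hP hUniq using h
  have hagree : ∀ S T t : ℝ, 0 ≤ t → t ≤ S → t ≤ T → U S t = U T t := by
    intro S T t ht hS hT
    have hmem : t ∈ Icc 0 t := ⟨ht, le_rfl⟩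
    rw [hUniq t ht _ ((hU S (ht.trans hS)).mono (Icc_subset_Icc_right hS)) hmem,
      hUniq t ht _ ((hU T (ht.trans hT)).mono (Icc_subset_Icc_right hT)) hmem]
  refine ⟨fun t => U t t, ⟨(hU 0 le_rfl).initial, fun t ht => ?_⟩,
    fun t ht => hP t ht t ⟨ht, le_rfl⟩, fun v hv t ht =>
      hUniq t ht v (hv.mono Icc_subset_Ici_self) ⟨ht, le_rfl⟩⟩
  have ht0 : (0 : ℝ) ≤ t := ht
  have hlt : t < t + 1 := lt_add_one t
  have hd := (hU (t + 1) (by linarith)).hasDerivWithinAt t ⟨ht0, hlt.le⟩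
  rw [← hagree t (t + 1) t ht0 le_rfl hlt.le] at hd
  have hnhds : Icc 0 (t + 1) ∈ 𝓝[Ici 0] t := by
    rw [← Ici_inter_Iic]
    exact inter_mem self_mem_nhdsWithin (mem_nhdsWithin_of_mem_nhds (Iic_mem_nhds hlt))
  refine (hd.mono_of_mem_nhdsWithin hnhds).congr_of_eventuallyEq ?_
    (hagree _ _ _ ht0 le_rfl hlt.le)
  filter_upwards [hnhds] with s hs
  exact hagree _ _ _ hs.1 le_rfl hs.2

end Barrier

/-! ### Bounds for the regularized inverse -/

section Resolvent

variable {H : Type*} [NormedAddCommGroup H] [InnerProductSpace ℝ H] [CompleteSpace H]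

theorem regNormalOp_apply (A : H →L[ℝ] H) (e : ℝ) (x : H) :
    regNormalOp A e x = normalOp A x + e • x := by
  simp [regNormalOp]

theorem regNormalOp_apply_inverse (A : H →L[ℝ] H) {e : ℝ} (he : 0 < e) (v : H) :
    regNormalOp A e ((regNormalOp A e).inverse v) = v :=
  (regNormalOp_isInvertible A he).self_apply_inverse v

/-- Energy identity from which both norm bounds below follow. -/
theorem inner_inverse_regNormalOp (A : H →L[ℝ] H) {e : ℝ} (he : 0 < e) (v : H) :
    inner ℝ v ((regNormalOp A e).inverse v)
      = ‖A ((regNormalOp A e).inverse v)‖ ^ 2 + e * ‖(regNormalOp A e).inverse v‖ ^ 2 := by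
  have h := regNormalOp_apply_inverse A he v
  set x := (regNormalOp A e).inverse v
  rw [← h, regNormalOp_apply]
  simp [normalOp, inner_add_left, ContinuousLinearMap.adjoint_inner_left, real_inner_smul_left]

theorem norm_inverse_regNormalOp_le (A : H →L[ℝ] H) {e : ℝ} (he : 0 < e) (v : H) :
    ‖(regNormalOp A e).inverse v‖ ≤ ‖v‖ / e := by
  have h := inner_inverse_regNormalOp A he v
  have hi := real_inner_le_norm v ((regNormalOp A e).inverse v)
  set x := (regNormalOp A e).inverse v
  rw [le_div_iff₀ he]
  rcases (norm_nonneg x).eq_or_lt with hx | hx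
  · rw [← hx, zero_mul]
    exact norm_nonneg v
  · refine le_of_mul_le_mul_right ?_ hx
    nlinarith [sq_nonneg ‖A x‖]

theorem norm_inverse_regNormalOp_adjoint_le (A : H →L[ℝ] H) {e : ℝ} (he : 0 < e) (k : H) :
    ‖(regNormalOp A e).inverse (ContinuousLinearMap.adjoint A k)‖ ≤ ‖k‖ / (2 * √e) := by
  have h := inner_inverse_regNormalOp A he (ContinuousLinearMap.adjoint A k)
  rw [ContinuousLinearMap.adjoint_inner_left] at h
  set x := (regNormalOp A e).inverse (ContinuousLinearMap.adjoint A k)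
  have hi := real_inner_le_norm k (A x)
  have hs : 0 < √e := Real.sqrt_pos.2 he
  rw [le_div_iff₀ (by positivity)]
  refine le_of_sq_le_sq ?_ (norm_nonneg k)
  rw [mul_pow, mul_pow, Real.sq_sqrt he.le]
  -- `e‖x‖² ≤ ‖k‖‖Ax‖ - ‖Ax‖² ≤ ‖k‖²/4`, by completing the square.
  nlinarith [sq_nonneg (‖k‖ - 2 * ‖A x‖)]

/-- `(A*A + e)⁻¹A*A = I - e(A*A + e)⁻¹`, and both terms have norm at most 1. -/
theorem norm_inverse_regNormalOp_normalOp_le (A : H →L[ℝ] H) {e : ℝ} (he : 0 < e) (z : H) :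
    ‖(regNormalOp A e).inverse (normalOp A z)‖ ≤ 2 * ‖z‖ := by
  have h : (regNormalOp A e).inverse (normalOp A z) = z - e • (regNormalOp A e).inverse z := by
    rw [(regNormalOp_isInvertible A he).inverse_apply_eq, map_sub, map_smul,
      regNormalOp_apply_inverse A he, regNormalOp_apply, add_sub_cancel_right]
  have h2 := norm_inverse_regNormalOp_le A he z
  rw [le_div_iff₀ he] at h2
  rw [h]
  refine (norm_sub_le _ _).trans ?_
  rw [norm_smul, Real.norm_of_nonneg he.le]
  linarith

theorem norm_normalOp_sub_le (A A' : H →L[ℝ] H) :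
    ‖normalOp A - normalOp A'‖ ≤ (‖A‖ + ‖A'‖) * ‖A - A'‖ := by
  have h : normalOp A - normalOp A' = (ContinuousLinearMap.adjoint A) ∘L (A - A')
      + (ContinuousLinearMap.adjoint (A - A')) ∘L A' := by
    ext x
    simp [normalOp]
  rw [h]
  refine (norm_add_le _ _).trans ((add_le_add (ContinuousLinearMap.opNorm_comp_le _ _)
    (ContinuousLinearMap.opNorm_comp_le _ _)).trans (le_of_eq ?_))
  rw [LinearIsometryEquiv.norm_map, LinearIsometryEquiv.norm_map]
  ring

/-- Second resolvent identity: the change of operator acts on `x'` as a perturbation of the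
right-hand side. -/
theorem norm_inverse_regNormalOp_sub_le (A A' : H →L[ℝ] H) {e : ℝ} (he : 0 < e) (r r' : H) :
    ‖(regNormalOp A e).inverse r - (regNormalOp A' e).inverse r'‖
      ≤ (‖r - r'‖ + (‖A‖ + ‖A'‖) * ‖A - A'‖ * (‖r'‖ / e)) / e := by
  set x' := (regNormalOp A' e).inverse r' with hx'
  have h : (regNormalOp A e).inverse r - x'
      = (regNormalOp A e).inverse (r - r' - (normalOp A - normalOp A') x') := by
    rw [eq_comm, (regNormalOp_isInvertible A he).inverse_apply_eq, map_sub,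
      regNormalOp_apply_inverse A he, regNormalOp_apply]
    conv_lhs => rw [← regNormalOp_apply_inverse A' he r', ← hx', regNormalOp_apply]
    simp only [sub_apply]
    abel
  rw [h]
  refine (norm_inverse_regNormalOp_le A he _).trans ?_
  gcongr
  refine (norm_sub_le _ _).trans ?_
  gcongr
  refine (ContinuousLinearMap.le_opNorm _ _).trans ?_
  gcongr
  · exact norm_normalOp_sub_le A A'
  · exact norm_inverse_regNormalOp_le A' he r'

end Resolvent

/-! ### Mean value estimates -/

section BoundedDerivatives

variable {H : Type*} [NormedAddCommGroup H] [InnerProductSpace ℝ H] {B : H → H} {s : Set H}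
  {M₁ M₂ : ℝ}

theorem HasBoundedDerivatives.of_sub_const {f : H}
    (h : HasBoundedDerivatives (fun u => B u - f) s M₁ M₂) : HasBoundedDerivatives B s M₁ M₂ := by
  have hd : fderiv ℝ (fun u => B u - f) = fderiv ℝ B := funext fun u => fderiv_sub_const f
  refine ⟨fun u hu => ?_, fun u hu => ?_, fun u hu => ?_, fun u hu => ?_⟩
  · simpa using (h.differentiableAt u hu).add_const f
  · exact hd ▸ h.differentiableAt_fderiv u hu
  · exact hd ▸ h.norm_fderiv_le u hu
  · exact hd ▸ h.norm_fderiv_fderiv_le u hu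

theorem HasBoundedDerivatives.norm_fderiv_sub_le (h : HasBoundedDerivatives B s M₁ M₂)
    (hs : Convex ℝ s) {u v : H} (hu : u ∈ s) (hv : v ∈ s) :
    ‖fderiv ℝ B u - fderiv ℝ B v‖ ≤ M₂ * ‖u - v‖ :=
  hs.norm_image_sub_le_of_norm_fderiv_le h.differentiableAt_fderiv h.norm_fderiv_fderiv_le hv hu

theorem HasBoundedDerivatives.norm_sub_le (h : HasBoundedDerivatives B s M₁ M₂)
    (hs : Convex ℝ s) {u v : H} (hu : u ∈ s) (hv : v ∈ s) : ‖B u - B v‖ ≤ M₁ * ‖u - v‖ :=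
  hs.norm_image_sub_le_of_norm_fderiv_le h.differentiableAt h.norm_fderiv_le hv hu

/-- Mean value inequality on the segment for `B` minus its derivative at `u`; the sharper Taylor
factor `1/2` is not needed. -/
theorem HasBoundedDerivatives.norm_linearization_le (h : HasBoundedDerivatives B s M₁ M₂)
    (hM₂ : 0 ≤ M₂) (hs : Convex ℝ s) {u v : H} (hu : u ∈ s) (hv : v ∈ s) :
    ‖B u - B v - fderiv ℝ B u (u - v)‖ ≤ M₂ * ‖u - v‖ ^ 2 := by
  have hsub := hs.segment_subset hu hv
  have := (convex_segment u v).norm_image_sub_le_of_norm_fderiv_le' (f := B)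
    (φ := fderiv ℝ B u) (C := M₂ * ‖u - v‖) (fun x hx => h.differentiableAt x (hsub hx))
    (fun x hx => (h.norm_fderiv_sub_le hs (hsub hx) hu).trans (by
      gcongr
      rw [norm_sub_rev, norm_sub_rev u v]
      rw [segment_eq_image'] at hx
      obtain ⟨θ, hθ, rfl⟩ := hx
      rw [sub_add_cancel_left, norm_neg, norm_smul, Real.norm_of_nonneg hθ.1]
      exact mul_le_of_le_one_left (norm_nonneg _) hθ.2))
    (right_mem_segment ℝ u v) (left_mem_segment ℝ u v)
  rwa [mul_assoc, ← sq] at this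

end BoundedDerivatives

/-! ### Estimates for the Gauss-Newton field -/

section Field

variable {H : Type*} [NormedAddCommGroup H] [InnerProductSpace ℝ H] [CompleteSpace H]
  {B : H → H} {y g p z u : H} {R M₁ M₂ : ℝ} {ε : ℝ → ℝ}

/-- The Gauss-Newton field is the sum of the contraction `y - u` and of the contributions of the
linearization error with the noise, and of the source element. -/
theorem gaussNewtonField_eq {t : ℝ} (ht : 0 < ε t) (hp : y - p = normalOp (fderiv ℝ B y) z) :
    gaussNewtonField B g p ε t u = -(u - y)
      - (regNormalOp (fderiv ℝ B u) (ε t)).inverse (ContinuousLinearMap.adjoint (fderiv ℝ B u)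
          (B u - g - fderiv ℝ B u (u - y)))
      - ε t • (regNormalOp (fderiv ℝ B u) (ε t)).inverse (normalOp (fderiv ℝ B y) z) := by
  have hw : (regNormalOp (fderiv ℝ B u) (ε t)).inverse
      (regNormalOp (fderiv ℝ B u) (ε t) (u - y)) = u - y :=
    (regNormalOp_isInvertible _ ht).inverse_apply_self _
  have hr : ContinuousLinearMap.adjoint (fderiv ℝ B u) (B u - g) + ε t • (u - p)
      = regNormalOp (fderiv ℝ B u) (ε t) (u - y)
        + ContinuousLinearMap.adjoint (fderiv ℝ B u) (B u - g - fderiv ℝ B u (u - y))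
        + ε t • normalOp (fderiv ℝ B y) z := by
    rw [← hp, regNormalOp_apply, map_sub _ (B u - g)]
    simp only [normalOp, ContinuousLinearMap.comp_apply]
    module
  rw [gaussNewtonField, hr, map_add, map_add, map_smul, hw]
  abel

theorem inner_gaussNewtonField_le (hB : HasBoundedDerivatives B (closedBall y R) M₁ M₂)
    (hM₂ : 0 ≤ M₂) (hu : u ∈ closedBall y R) {t : ℝ} (ht : 0 < ε t)
    (hp : y - p = normalOp (fderiv ℝ B y) z) :
    inner ℝ (u - y) (gaussNewtonField B g p ε t u) ≤ -‖u - y‖ ^ 2 + ‖u - y‖ *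
      ((M₂ * ‖u - y‖ ^ 2 + ‖g - B y‖) / (2 * √(ε t)) + 2 * ε t * ‖z‖
        + 2 * M₁ * M₂ * ‖u - y‖ * ‖z‖) := by
  have hR : 0 ≤ R := dist_nonneg.trans (mem_closedBall.1 hu)
  have hy : y ∈ closedBall y R := mem_closedBall_self hR
  have hconv := convex_closedBall y R
  set A := fderiv ℝ B u with hA
  set k := B u - g - A (u - y) with hk
  set q₁ := (regNormalOp A (ε t)).inverse (ContinuousLinearMap.adjoint A k) with hq₁
  set q₂ := (regNormalOp A (ε t)).inverse (normalOp (fderiv ℝ B y) z) with hq₂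
  have hknorm : ‖k‖ ≤ M₂ * ‖u - y‖ ^ 2 + ‖g - B y‖ := by
    have : k = (B u - B y - A (u - y)) - (g - B y) := by rw [hk]; abel
    rw [this]
    exact (norm_sub_le _ _).trans (by gcongr; exact hB.norm_linearization_le hM₂ hconv hu hy)
  have hq₁norm : ‖q₁‖ ≤ (M₂ * ‖u - y‖ ^ 2 + ‖g - B y‖) / (2 * √(ε t)) :=
    (norm_inverse_regNormalOp_adjoint_le A ht k).trans (by gcongr)
  have hq₂norm : ε t * ‖q₂‖ ≤ 2 * ε t * ‖z‖ + 2 * M₁ * M₂ * ‖u - y‖ * ‖z‖ := by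
    -- The source condition involves the derivative at `y`, the resolvent the one at `u`; replacing
    -- the former by the latter costs a term of order `‖u - y‖ ‖z‖`.
    have hsplit : q₂ = (regNormalOp A (ε t)).inverse (normalOp A z)
        - (regNormalOp A (ε t)).inverse ((normalOp A - normalOp (fderiv ℝ B y)) z) := by
      rw [← map_sub, hq₂]
      simp
    have h1 := norm_inverse_regNormalOp_normalOp_le A ht z
    have h2 := norm_inverse_regNormalOp_le A ht ((normalOp A - normalOp (fderiv ℝ B y)) z)
    have h3 : ‖(normalOp A - normalOp (fderiv ℝ B y)) z‖ ≤ 2 * M₁ * M₂ * ‖u - y‖ * ‖z‖ := by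
      refine (ContinuousLinearMap.le_opNorm _ _).trans ?_
      gcongr
      refine (norm_normalOp_sub_le _ _).trans ?_
      rw [mul_assoc (2 * M₁)]
      have hM₁ : 0 ≤ M₁ := (norm_nonneg _).trans (hB.norm_fderiv_le u hu)
      gcongr
      · linarith [hB.norm_fderiv_le u hu, hB.norm_fderiv_le y hy]
      · exact hB.norm_fderiv_sub_le hconv hu hy
    rw [le_div_iff₀ ht] at h2
    have h4 := norm_sub_le ((regNormalOp A (ε t)).inverse (normalOp A z))
      ((regNormalOp A (ε t)).inverse ((normalOp A - normalOp (fderiv ℝ B y)) z))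
    rw [← hsplit] at h4
    nlinarith
  rw [gaussNewtonField_eq ht hp, inner_sub_right, inner_sub_right, inner_neg_right,
    real_inner_self_eq_norm_sq]
  have h1 := neg_le_of_abs_le (abs_real_inner_le_norm (u - y) q₁)
  have h2 := neg_le_of_abs_le (abs_real_inner_le_norm (u - y) (ε t • q₂))
  rw [norm_smul, Real.norm_of_nonneg ht.le] at h2
  have h3 := mul_le_mul_of_nonneg_left (add_le_add hq₁norm hq₂norm) (norm_nonneg (u - y))
  linarith

theorem continuousOn_gaussNewtonField {I : Set ℝ} (hε : ContinuousOn ε I)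
    (hpos : ∀ t ∈ I, 0 < ε t) (u : H) :
    ContinuousOn (fun t => gaussNewtonField B g p ε t u) I := by
  intro t ht
  have hinv : ContinuousWithinAt
      (fun t => (regNormalOp (fderiv ℝ B u) (ε t)).inverse) I t := by
    obtain ⟨w, hw⟩ := regNormalOp_isInvertible (fderiv ℝ B u) (hpos t ht)
    have hc : ContinuousAt ContinuousLinearMap.inverse (regNormalOp (fderiv ℝ B u) (ε t)) := by
      rw [← hw]
      exact (contDiffAt_map_inverse (𝕜 := ℝ) (n := 0) w).continuousAt
    refine hc.comp_continuousWithinAt (f := fun t => regNormalOp (fderiv ℝ B u) (ε t)) ?_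
    exact continuousWithinAt_const.add ((hε t ht).smul continuousWithinAt_const)
  exact (hinv.clm_apply
    (continuousWithinAt_const.add ((hε t ht).smul continuousWithinAt_const))).neg

/-- The constant is uniform in time only while `ε ≥ a > 0`, so it serves bounded intervals; the
half-line is reached by gluing. -/
theorem lipschitzOnWith_gaussNewtonField
    (hB : HasBoundedDerivatives B (closedBall y R) M₁ M₂) (hM₂ : 0 ≤ M₂) (hR : 0 ≤ R)
    (g p : H) {a b : ℝ} (ha : 0 < a) :
    ∃ K : NNReal, ∀ (ε : ℝ → ℝ) (t : ℝ), a ≤ ε t → ε t ≤ b →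
      LipschitzOnWith K (gaussNewtonField B g p ε t) (closedBall y R) := by
  have hy : y ∈ closedBall y R := mem_closedBall_self hR
  have hconv := convex_closedBall y R
  have hM₁ : 0 ≤ M₁ := (norm_nonneg _).trans (hB.norm_fderiv_le y hy)
  set D := M₁ * R + ‖B y - g‖ with hD
  set C := M₁ * D + b * (R + ‖y - p‖) with hC
  refine ⟨((M₂ * D + M₁ * M₁ + b + 2 * M₁ * M₂ * (C / a)) / a).toNNReal,
    fun ε t hae hbe => LipschitzOnWith.of_dist_le_mul fun u hu v hv => ?_⟩
  have hb : 0 < b := ha.trans_le (hae.trans hbe)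
  have hres : ∀ x ∈ closedBall y R, ‖B x - g‖ ≤ D := fun x hx => by
    have h1 := hB.norm_sub_le hconv hx hy
    rw [mem_closedBall, dist_eq_norm] at hx
    have h2 := norm_sub_le_norm_sub_add_norm_sub (B x) (B y) g
    have h3 : M₁ * ‖x - y‖ ≤ M₁ * R := by gcongr
    linarith
  have hD0 : 0 ≤ D := by positivity
  have hC0 : 0 ≤ C := by positivity
  have hA : ∀ x ∈ closedBall y R, ‖ContinuousLinearMap.adjoint (fderiv ℝ B x)‖ ≤ M₁ :=
    fun x hx => by
      rw [LinearIsometryEquiv.norm_map]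
      exact hB.norm_fderiv_le x hx
  set r : H → H := fun x =>
    ContinuousLinearMap.adjoint (fderiv ℝ B x) (B x - g) + ε t • (x - p) with hr
  have het : 0 < ε t := ha.trans_le hae
  have hrv : ‖r v‖ ≤ C := by
    refine (norm_add_le _ _).trans ?_
    rw [norm_smul, Real.norm_of_nonneg het.le]
    refine add_le_add ((ContinuousLinearMap.le_opNorm _ _).trans
      (mul_le_mul (hA v hv) (hres v hv) (norm_nonneg _) hM₁)) ?_
    have h2 := norm_sub_le_norm_sub_add_norm_sub v y p
    rw [mem_closedBall, dist_eq_norm] at hv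
    gcongr
    linarith
  have hruv : ‖r u - r v‖ ≤ (M₂ * D + M₁ * M₁ + b) * ‖u - v‖ := by
    have hsplit : r u - r v
        = ContinuousLinearMap.adjoint (fderiv ℝ B u - fderiv ℝ B v) (B u - g)
          + ContinuousLinearMap.adjoint (fderiv ℝ B v) (B u - B v) + ε t • (u - v) := by
      simp only [hr, map_sub, sub_apply]
      module
    rw [hsplit]
    refine (norm_add₃_le).trans ?_
    rw [norm_smul, Real.norm_of_nonneg het.le]
    have h1 : ‖ContinuousLinearMap.adjoint (fderiv ℝ B u - fderiv ℝ B v) (B u - g)‖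
        ≤ (M₂ * ‖u - v‖) * D := by
      refine (ContinuousLinearMap.le_opNorm _ _).trans ?_
      rw [LinearIsometryEquiv.norm_map]
      exact mul_le_mul (hB.norm_fderiv_sub_le hconv hu hv) (hres u hu) (norm_nonneg _)
        (by positivity)
    have h2 : ‖ContinuousLinearMap.adjoint (fderiv ℝ B v) (B u - B v)‖
        ≤ M₁ * (M₁ * ‖u - v‖) :=
      (ContinuousLinearMap.le_opNorm _ _).trans
        (mul_le_mul (hA v hv) (hB.norm_sub_le hconv hu hv) (norm_nonneg _) hM₁)
    have h3 : ε t * ‖u - v‖ ≤ b * ‖u - v‖ := by gcongr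
    linarith
  rw [dist_eq_norm, dist_eq_norm, Real.coe_toNNReal _ (by positivity)]
  have hneg : gaussNewtonField B g p ε t u - gaussNewtonField B g p ε t v
      = -((regNormalOp (fderiv ℝ B u) (ε t)).inverse (r u)
        - (regNormalOp (fderiv ℝ B v) (ε t)).inverse (r v)) := by
    simp only [gaussNewtonField, hr]
    abel
  rw [hneg, norm_neg]
  refine (norm_inverse_regNormalOp_sub_le _ _ het _ _).trans ?_
  have h4 : (‖fderiv ℝ B u‖ + ‖fderiv ℝ B v‖) * ‖fderiv ℝ B u - fderiv ℝ B v‖ * (‖r v‖ / ε t)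
      ≤ (M₁ + M₁) * (M₂ * ‖u - v‖) * (C / a) := by
    gcongr
    · exact hB.norm_fderiv_le u hu
    · exact hB.norm_fderiv_le v hv
    · exact hB.norm_fderiv_sub_le hconv hu hv
  calc _ ≤ ((M₂ * D + M₁ * M₁ + b) * ‖u - v‖ + (M₁ + M₁) * (M₂ * ‖u - v‖) * (C / a)) / a := by
        gcongr
    _ = _ := by ring

end Field

/-! ### Properties of the regularization function -/

namespace IsRegularizationFunction

variable {ε : ℝ → ℝ}

theorem hasDerivWithinAt (hε : IsRegularizationFunction ε) {t : ℝ} (ht : 0 ≤ t) :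
    HasDerivWithinAt ε (derivWithin ε (Ici 0) t) (Ici 0) t :=
  (hε.differentiableOn t ht).hasDerivWithinAt

theorem neg_lt_derivWithin (hε : IsRegularizationFunction ε) {t : ℝ} (ht : 0 ≤ t) :
    -ε t < derivWithin ε (Ici 0) t := by
  have h := hε.relative_decay t ht
  rw [div_lt_one (hε.pos t ht)] at h
  exact (abs_lt.1 h).1

theorem continuousOn (hε : IsRegularizationFunction ε) : ContinuousOn ε (Ici 0) :=
  hε.differentiableOn.continuousOn

theorem le_zero_value (hε : IsRegularizationFunction ε) {t : ℝ} (ht : 0 ≤ t) : ε t ≤ ε 0 :=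
  hε.antitoneOn self_mem_Ici ht ht

theorem exists_eq (hε : IsRegularizationFunction ε) {c : ℝ} (hc : 0 < c) (hc0 : c ≤ ε 0) :
    ∃ t, 0 ≤ t ∧ ε t = c := by
  obtain ⟨T, hT, hT0⟩ :=
    ((hε.tendsto_zero.eventually_lt_const hc).and (eventually_ge_atTop 0)).exists
  obtain ⟨t, ht, h⟩ := intermediate_value_Icc' hT0
    (hε.continuousOn.mono Icc_subset_Ici_self) ⟨hT.le, hc0⟩
  exact ⟨t, ht.1, h⟩

end IsRegularizationFunction

/-! ### The barrier `κ²ε` for the flow -/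

section Flow

variable {H : Type*} [NormedAddCommGroup H] [InnerProductSpace ℝ H] [CompleteSpace H]
  {B : H → H} {y g p z u u₀ : H} {R M₁ M₂ κ : ℝ} {ε : ℝ → ℝ}

/-- With `s = √ε(t)`, linearization and noise contribute at most `κs/4`, the two source terms
`κs/16` each. Thus `2⟨w, Φ⟩ ≤ (-2 + 3/4)κ²s²`, strictly below `-κ²s²`. -/
theorem inner_gaussNewtonField_lt (hB : HasBoundedDerivatives B (closedBall y R) M₁ M₂)
    (hM₂ : 0 ≤ M₂) (hu : u ∈ closedBall y R) {t : ℝ} (ht : 0 < ε t)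
    (hp : y - p = normalOp (fderiv ℝ B y) z) (hκ : 0 < κ) (hκM : M₂ * κ ≤ 1 / 4)
    (hz : √(ε t) * ‖z‖ ≤ κ / 32) (hzM : M₁ * M₂ * ‖z‖ ≤ 1 / 32)
    (hg : ‖g - B y‖ ≤ κ / 4 * ε t) (hbd : ‖u - y‖ ^ 2 = κ ^ 2 * ε t) :
    2 * inner ℝ (u - y) (gaussNewtonField B g p ε t u) < -(κ ^ 2 * ε t) := by
  have h := inner_gaussNewtonField_le (g := g) hB hM₂ hu ht hp
  set s := √(ε t) with hs
  have hs0 : 0 < s := Real.sqrt_pos.2 ht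
  have hsq : ε t = s ^ 2 := (Real.sq_sqrt ht.le).symm
  have hw : ‖u - y‖ = κ * s := by
    rw [hsq, ← mul_pow] at hbd
    exact (sq_eq_sq₀ (norm_nonneg _) (by positivity)).1 hbd
  rw [hw, hsq] at h
  rw [hsq] at hg ⊢
  have h1 : (M₂ * (κ * s) ^ 2 + ‖g - B y‖) / (2 * s) ≤ κ * s / 4 := by
    rw [div_le_iff₀ (by positivity)]
    have := mul_le_mul_of_nonneg_right hκM (by positivity : 0 ≤ κ * s ^ 2)
    nlinarith
  have h2 : 2 * s ^ 2 * ‖z‖ ≤ κ * s / 16 := by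
    have := mul_le_mul_of_nonneg_right hz hs0.le
    nlinarith
  have h3 : 2 * M₁ * M₂ * (κ * s) * ‖z‖ ≤ κ * s / 16 := by
    have := mul_le_mul_of_nonneg_right hzM (by positivity : 0 ≤ κ * s)
    nlinarith
  have h4 := mul_le_mul_of_nonneg_left (add_le_add (add_le_add h1 h2) h3)
    (by positivity : 0 ≤ κ * s)
  have h5 : 0 < (κ * s) ^ 2 := by positivity
  nlinarith

/-- As long as the noise is dominated by `ε`, the Gauss-Newton flow has a unique solution, which
stays within distance `κ √ε` of `y`. -/
theorem exists_unique_gaussNewton_solution (hε : IsRegularizationFunction ε)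
    (hB : HasBoundedDerivatives B (closedBall y R) M₁ M₂) (hM₂ : 0 ≤ M₂) (hR : 0 < R)
    (hu₀ : u₀ ∈ closedBall y R) (hp : y - p = normalOp (fderiv ℝ B y) z) (hκ : 0 < κ)
    (hκR : κ ^ 2 * ε 0 = R ^ 2) (hκM : M₂ * κ ≤ 1 / 4) (hz : √(ε 0) * ‖z‖ ≤ κ / 32)
    (hzM : M₁ * M₂ * ‖z‖ ≤ 1 / 32) {T : ℝ} (hT : 0 ≤ T) (hg : ‖g - B y‖ ≤ κ / 4 * ε T) :
    ∃ v : ℝ → H, IsSolutionOn (gaussNewtonField B g p ε) u₀ (Icc 0 T) v ∧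
      (∀ t ∈ Icc 0 T, ‖v t - y‖ ^ 2 ≤ κ ^ 2 * ε t) ∧
      ∀ w : ℝ → H, IsSolutionOn (gaussNewtonField B g p ε) u₀ (Icc 0 T) w →
        EqOn w v (Icc 0 T) := by
  obtain ⟨K, hK⟩ := lipschitzOnWith_gaussNewtonField hB hM₂ hR.le g p (b := ε 0) (hε.pos T hT)
  have hTt : ∀ t ∈ Icc 0 T, ε T ≤ ε t := fun t ht => hε.antitoneOn ht.1 hT ht.2
  have hbR : ∀ t ∈ Icc 0 T, κ ^ 2 * ε t ≤ R ^ 2 := fun t ht => by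
    rw [← hκR]
    exact mul_le_mul_of_nonneg_left (hε.le_zero_value ht.1) (sq_nonneg κ)
  refine exists_unique_solution_of_barrier
    (b' := fun t => κ ^ 2 * derivWithin ε (Ici 0) t) hT hR
    (fun t ht => hK ε t (hTt t ht) (hε.le_zero_value ht.1))
    (fun x _ => continuousOn_gaussNewtonField (hε.continuousOn.mono Icc_subset_Ici_self)
      (fun t ht => hε.pos t ht.1) x)
    (fun t ht => ((hε.hasDerivWithinAt ht.1).mono Icc_subset_Ici_self).const_mul _)
    hbR ?_ fun t ht x hx => ?_
  · rw [hκR]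
    rw [mem_closedBall, dist_eq_norm] at hu₀
    gcongr
  · have ht' := Ico_subset_Icc_self ht
    have hxR : x ∈ closedBall y R := by
      rw [mem_closedBall, dist_eq_norm]
      exact le_of_sq_le_sq (hx.le.trans (hbR t ht')) hR.le
    have hz' : √(ε t) * ‖z‖ ≤ κ / 32 :=
      (mul_le_mul_of_nonneg_right (Real.sqrt_le_sqrt (hε.le_zero_value ht.1))
        (norm_nonneg z)).trans hz
    have hg' : ‖g - B y‖ ≤ κ / 4 * ε t :=
      hg.trans (mul_le_mul_of_nonneg_left (hTt t ht') (by positivity))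
    have h := inner_gaussNewtonField_lt hB hM₂ hxR (hε.pos t ht.1) hp hκ hκM hz' hzM hg' hx
    have h' := mul_lt_mul_of_pos_left (hε.neg_lt_derivWithin ht.1) (sq_pos_of_pos hκ)
    linarith

end Flow

/-! ### Choice of constants and stopping times -/

theorem theorem5p1 (ε : ℝ → ℝ) (hε : IsRegularizationFunction ε) (M₁ M₂ : ℝ) (hM₂ : 0 < M₂) :
    -- "R sufficiently small"
    ∃ R₀ : ℝ, 0 < R₀ ∧ ∀ R : ℝ, 0 < R → R ≤ R₀ →
    -- "z sufficiently small"
    ∃ ζ : ℝ, 0 < ζ ∧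
    ∀ (H : Type*) [NormedAddCommGroup H] [InnerProductSpace ℝ H] [CompleteSpace H]
      (B : H → H) (f y u₀ p z : H),
      HasBoundedDerivatives (fun u => B u - f) (closedBall y R) M₁ M₂ →
      B y - f = 0 →
      u₀ ∈ closedBall y R →
      y - p = normalOp (fderiv ℝ B y) z →
      ‖z‖ ≤ ζ →
      -- exact data: unique global solution, rate, and convergence to the solution `y`
      (∃ u : ℝ → H,
        IsSolutionOn (gaussNewtonField B f p ε) u₀ (Ici 0) u ∧
        (∀ v : ℝ → H, IsSolutionOn (gaussNewtonField B f p ε) u₀ (Ici 0) v →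
          EqOn v u (Ici 0)) ∧
        (∀ t ∈ Ici (0 : ℝ), u t ∈ closedBall y R) ∧
        (∀ t ∈ Ici (0 : ℝ), ‖u t - y‖ < √(ε t) / (2 * M₂)) ∧
        Tendsto u atTop (𝓝 y)) ∧
      -- noisy data: a stopping time depending on the noise level `δ` only, valid uniformly in all
      -- data `g` with `‖g - f‖ ≤ δ`
      (∃ τ : ℝ → ℝ, (∀ δ, 0 < δ → 0 ≤ τ δ) ∧
        ∀ η : ℝ, 0 < η → ∀ᶠ δ in 𝓝[>] (0 : ℝ), ∀ g : H, ‖g - f‖ ≤ δ →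
          ∃ v : ℝ → H,
            IsSolutionOn (gaussNewtonField B g p ε) u₀ (Icc 0 (τ δ)) v ∧
            (∀ w : ℝ → H, IsSolutionOn (gaussNewtonField B g p ε) u₀ (Icc 0 (τ δ)) w →
              EqOn w v (Icc 0 (τ δ))) ∧
            ‖v (τ δ) - y‖ < η) := by
  have hε0 : 0 < ε 0 := hε.pos 0 self_mem_Ici
  have hs0 : 0 < √(ε 0) := Real.sqrt_pos.2 hε0
  -- This `R₀` encodes `M₂κ ≤ 1/4`, which absorbs the quadratic error.
  refine ⟨√(ε 0) / (4 * M₂), by positivity, fun R hR hRle => ?_⟩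
  set κ := R / √(ε 0) with hκdef
  have hκ : 0 < κ := by positivity
  have hκs : κ * √(ε 0) = R := by
    rw [hκdef]
    field_simp
  have hκR : κ ^ 2 * ε 0 = R ^ 2 := by rw [← hκs, mul_pow, Real.sq_sqrt hε0.le]
  have hκM : M₂ * κ ≤ 1 / 4 := by
    rw [hκdef, ← mul_div_assoc, div_le_iff₀ hs0]
    rw [le_div_iff₀ (by positivity)] at hRle
    linarith
  -- One entry for each source term; the `+ 1` covers `M₁ = 0`.
  refine ⟨min (κ / (32 * √(ε 0))) (1 / (32 * (|M₁| * M₂ + 1))),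
    lt_min (by positivity) (by positivity), ?_⟩
  intro H _ _ _ B f y u₀ p z hF hy hu₀ hp hζ
  have hB := hF.of_sub_const
  have hBy : B y = f := sub_eq_zero.1 hy
  have hz : √(ε 0) * ‖z‖ ≤ κ / 32 := by
    have := hζ.trans (min_le_left _ _)
    rw [le_div_iff₀ (by positivity)] at this
    linarith
  have hzM : M₁ * M₂ * ‖z‖ ≤ 1 / 32 := by
    have h := hζ.trans (min_le_right _ _)
    rw [le_div_iff₀ (by positivity)] at h
    have h1 : M₁ * M₂ * ‖z‖ ≤ |M₁| * M₂ * ‖z‖ := by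
      gcongr
      exact le_abs_self M₁
    nlinarith [norm_nonneg z]
  have hsol : ∀ (g : H) (T : ℝ), 0 ≤ T → ‖g - f‖ ≤ κ / 4 * ε T → _ := fun g T hT hg =>
    exists_unique_gaussNewton_solution (g := g) hε hB hM₂.le hR hu₀ hp hκ hκR hκM hz hzM hT
      (by rwa [hBy])
  have hroot : ∀ {t : ℝ} {x : H}, ‖x - y‖ ^ 2 ≤ κ ^ 2 * ε t → ‖x - y‖ ≤ κ * √(ε t) := by
    intro t x hx
    refine (Real.le_sqrt_of_sq_le hx).trans (le_of_eq ?_)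
    rw [Real.sqrt_mul (sq_nonneg κ), Real.sqrt_sq hκ.le]
  refine ⟨?_, ?_⟩
  · obtain ⟨u, hu, hub, huniq⟩ := exists_unique_solution_Ici
      (fun t x => ‖x - y‖ ^ 2 ≤ κ ^ 2 * ε t) fun T hT => hsol f T hT (by
        rw [sub_self, norm_zero]
        have := hε.pos T hT
        positivity)
    refine ⟨u, hu, huniq, fun t ht => ?_, fun t ht => ?_, ?_⟩
    · rw [mem_closedBall, dist_eq_norm, ← hκs]
      refine (hroot (hub t ht)).trans ?_
      gcongr
      exact hε.le_zero_value ht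
    · have hst : 0 < √(ε t) := Real.sqrt_pos.2 (hε.pos t ht)
      refine (hroot (hub t ht)).trans_lt ?_
      rw [lt_div_iff₀ (by positivity)]
      nlinarith
    · rw [tendsto_iff_norm_sub_tendsto_zero]
      have hlim : Tendsto (fun t => κ * √(ε t)) atTop (𝓝 0) := by
        simpa using (hε.tendsto_zero.sqrt).const_mul κ
      refine squeeze_zero' (Eventually.of_forall fun t => norm_nonneg _) ?_ hlim
      filter_upwards [eventually_ge_atTop 0] with t ht
      exact hroot (hub t ht)
  -- Solving `ε(τ) = 4δ/κ` makes the noise condition `δ ≤ κε(τ)/4` an equality. The default 0 is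
  -- used only for `δ ≤ 0` or for `δ` too large, irrelevant in the limit.
  · have hτ : ∀ δ : ℝ, ∃ t : ℝ, 0 ≤ t ∧ (0 < δ → 4 * δ / κ ≤ ε 0 → ε t = 4 * δ / κ) := by
      intro δ
      by_cases h : 0 < δ ∧ 4 * δ / κ ≤ ε 0
      · obtain ⟨t, ht, hteq⟩ := hε.exists_eq (by have := h.1; positivity) h.2
        exact ⟨t, ht, fun _ _ => hteq⟩
      · exact ⟨0, le_rfl, fun h1 h2 => absurd ⟨h1, h2⟩ h⟩
    choose τ hτ0 hτeq using hτ
    refine ⟨τ, fun δ _ => hτ0 δ, fun η hη => ?_⟩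
    have hlim : Tendsto (fun δ : ℝ => 4 * δ / κ) (𝓝[>] 0) (𝓝 0) :=
      tendsto_nhdsWithin_of_tendsto_nhds
        (Continuous.tendsto' (by fun_prop) _ _ (by simp))
    have hlim' : Tendsto (fun δ : ℝ => κ * √(4 * δ / κ)) (𝓝[>] 0) (𝓝 0) := by
      simpa using hlim.sqrt.const_mul κ
    filter_upwards [self_mem_nhdsWithin, hlim.eventually_lt_const hε0,
      hlim'.eventually_lt_const hη] with δ hδ hδ0 hδη g hg
    have heq := hτeq δ hδ hδ0.le
    obtain ⟨v, hv, hvb, huniq⟩ := hsol g (τ δ) (hτ0 δ) (hg.trans (le_of_eq (by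
      rw [heq]
      field_simp)))
    refine ⟨v, hv, huniq, (hroot (hvb _ ⟨hτ0 δ, le_rfl⟩)).trans_lt ?_⟩
    rwa [heq]
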